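/- Let $X$ be a compact Hausdorff space, let $C(X)$ be the ring of real-valued continuous functions on $X$, and let $\mathcal{M}(C(X))$ be the space of minimal prime ideals of $C(X)$ with the Zariski topology, i.e. the topology having as a basis of open sets the sets $D(f)=\{P\in\mathcal{M}(C(X)) : f\notin P\}$, $f\in C(X)$. Then every first category subset of $X$ (that is, every countable union of nowhere dense subsets of $X$) is nowhere dense in $X$ if and only if every first category subset of $\mathcal{M}(C(X))$ is nowhere dense in $\mathcal{M}(C(X))$. -/

import Mathlib

/-- The space of minimal prime ideals of a commutative ring `R`. -/
def MinimalPrimeSpace (R : Type*) [CommRing R] : Type _ :=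
  {P : Ideal R // P ∈ minimalPrimes R}

namespace MinimalPrimeSpace

/-- `D(a)`: the set of minimal prime ideals of `R` that do not contain `a`. -/
def D {R : Type*} [CommRing R] (a : R) : Set (MinimalPrimeSpace R) :=
  {P | a ∉ P.1}

/-- The Zariski topology on the space of minimal prime ideals, generated by the sets `D(a)`. -/
instance zariskiTopology (R : Type*) [CommRing R] : TopologicalSpace (MinimalPrimeSpace R) :=
  TopologicalSpace.generateFrom (Set.range (D (R := R)))

/-- The sets `D(a)` are not only a subbasis but a basis of the topology. -/
theorem isTopologicalBasis_D (R : Type*) [CommRing R] :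
    TopologicalSpace.IsTopologicalBasis (Set.range (D (R := R))) where
  exists_subset_inter := by
    rintro _ ⟨a, rfl⟩ _ ⟨b, rfl⟩ P ⟨ha, hb⟩
    refine ⟨D (a * b), ⟨a * b, rfl⟩, fun h => ?_, fun Q hQ => ⟨fun h => hQ ?_, fun h => hQ ?_⟩⟩
    · exact (Ideal.IsMinimalPrime.isPrime P.2).mem_or_mem h |>.elim ha hb
    · exact Q.1.mul_mem_right b h
    · exact Q.1.mul_mem_left a h
  sUnion_eq := by
    refine Set.eq_univ_of_forall fun P => ⟨D 1, ⟨1, rfl⟩, fun h => ?_⟩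
    exact (Ideal.IsMinimalPrime.isPrime P.2).ne_top ((Ideal.eq_top_iff_one _).2 h)
  eq_generateFrom := rfl

end MinimalPrimeSpace

/-! Each minimal prime of `C(X, ℝ)` lies in the maximal ideal of functions vanishing at a unique
point of `X`. The resulting map `point` is a continuous surjection, and it is irreducible: `D f`
contains the preimage of the cozero set of `f`. Images and preimages along such a map preserve
nowhere dense sets, hence meagre sets, so the property transfers both ways. -/

section NowhereDense

variable {X Y : Type*} [TopologicalSpace X] [TopologicalSpace Y]

/-- A set is nowhere dense iff every nonempty open set contains a nonempty open set missing it. -/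
theorem isNowhereDense_iff_exists_isOpen_disjoint {s : Set X} :
    IsNowhereDense s ↔ ∀ U : Set X, IsOpen U → U.Nonempty →
      ∃ V ⊆ U, IsOpen V ∧ V.Nonempty ∧ Disjoint V s := by
  constructor
  · intro hs U hU hne
    refine ⟨U ∩ (closure s)ᶜ, Set.inter_subset_left, hU.inter isClosed_closure.isOpen_compl, ?_,
      Set.disjoint_left.2 fun x hx hxs => hx.2 (subset_closure hxs)⟩
    by_contra hempty
    have hsub : U ⊆ interior (closure s) := hU.subset_interior_iff.2 fun x hx => by
      by_contra hxs
      exact hempty ⟨x, hx, hxs⟩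
    rw [IsNowhereDense] at hs
    rw [hs] at hsub
    exact hne.not_subset_empty hsub
  · intro h
    rw [IsNowhereDense, ← Set.not_nonempty_iff_eq_empty]
    intro hne
    obtain ⟨V, hVU, hV, ⟨x, hx⟩, hVs⟩ := h _ isOpen_interior hne
    obtain ⟨y, hyV, hys⟩ := mem_closure_iff.1 (interior_subset (hVU hx)) V hV hx
    exact Set.disjoint_left.1 hVs hyV hys

variable {f : Y → X}

/-- Nowhere dense sets pull back to nowhere dense sets along a continuous surjection for which every
nonempty open set contains the preimage of a nonempty open set. -/
theorem IsNowhereDense.preimage_of_irreducible (hf : Continuous f) (hsurj : f.Surjective)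
    (hirr : ∀ V : Set Y, IsOpen V → V.Nonempty → ∃ U : Set X, IsOpen U ∧ U.Nonempty ∧ f ⁻¹' U ⊆ V)
    {s : Set X} (hs : IsNowhereDense s) : IsNowhereDense (f ⁻¹' s) := by
  rw [isNowhereDense_iff_exists_isOpen_disjoint] at hs ⊢
  intro V hV hne
  obtain ⟨U, hU, hUne, hUV⟩ := hirr V hV hne
  obtain ⟨W, hWU, hW, hWne, hWs⟩ := hs U hU hUne
  exact ⟨f ⁻¹' W, (Set.preimage_mono hWU).trans hUV, hW.preimage hf, hWne.preimage hsurj,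
    hWs.preimage f⟩

/-- Nowhere dense sets map to nowhere dense sets under a continuous surjection for which every
nonempty open set contains the preimage of a nonempty open set. -/
theorem IsNowhereDense.image_of_irreducible (hf : Continuous f) (hsurj : f.Surjective)
    (hirr : ∀ V : Set Y, IsOpen V → V.Nonempty → ∃ U : Set X, IsOpen U ∧ U.Nonempty ∧ f ⁻¹' U ⊆ V)
    {s : Set Y} (hs : IsNowhereDense s) : IsNowhereDense (f '' s) := by
  rw [isNowhereDense_iff_exists_isOpen_disjoint] at hs ⊢
  intro U hU hne
  obtain ⟨V, hVU, hV, hVne, hVs⟩ := hs (f ⁻¹' U) (hU.preimage hf) (hne.preimage hsurj)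
  obtain ⟨W, hW, hWne, hWV⟩ := hirr V hV hVne
  refine ⟨W, ?_, hW, hWne, ?_⟩
  · rw [← Set.image_preimage_eq W hsurj]
    exact Set.image_subset_iff.2 (hWV.trans hVU)
  · rw [Set.disjoint_left]
    rintro _ hxW ⟨y, hys, rfl⟩
    exact Set.disjoint_left.1 hVs (hWV hxW) hys

/-- The property that meagre sets are nowhere dense is shared by the domain and the codomain of a
continuous surjection for which every nonempty open set contains the preimage of a nonempty open
set. -/
theorem forall_isMeagre_isNowhereDense_iff_of_irreducible (hf : Continuous f)
    (hsurj : f.Surjective)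
    (hirr : ∀ V : Set Y, IsOpen V → V.Nonempty → ∃ U : Set X, IsOpen U ∧ U.Nonempty ∧ f ⁻¹' U ⊆ V) :
    (∀ A : Set X, IsMeagre A → IsNowhereDense A) ↔
      (∀ B : Set Y, IsMeagre B → IsNowhereDense B) := by
  constructor
  · intro h B hB
    obtain ⟨S, hS, hcount, hBS⟩ := isMeagre_iff_countable_union_isNowhereDense.1 hB
    have himage : IsMeagre (f '' B) := by
      refine isMeagre_iff_countable_union_isNowhereDense.2
        ⟨Set.image f '' S, ?_, hcount.image _, ?_⟩
      · rintro _ ⟨t, ht, rfl⟩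
        exact (hS t ht).image_of_irreducible hf hsurj hirr
      · rintro _ ⟨y, hy, rfl⟩
        obtain ⟨t, ht, hyt⟩ := hBS hy
        exact ⟨f '' t, ⟨t, ht, rfl⟩, y, hyt, rfl⟩
    exact ((h _ himage).preimage_of_irreducible hf hsurj hirr).mono (Set.subset_preimage_image f B)
  · intro h A hA
    obtain ⟨S, hS, hcount, hAS⟩ := isMeagre_iff_countable_union_isNowhereDense.1 hA
    have hpre : IsMeagre (f ⁻¹' A) := by
      refine isMeagre_iff_countable_union_isNowhereDense.2
        ⟨Set.preimage f '' S, ?_, hcount.image _, ?_⟩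
      · rintro _ ⟨t, ht, rfl⟩
        exact (hS t ht).preimage_of_irreducible hf hsurj hirr
      · intro y hy
        obtain ⟨t, ht, hyt⟩ := hAS hy
        exact ⟨f ⁻¹' t, ⟨t, ht, rfl⟩, hyt⟩
    rw [← Set.image_preimage_eq A hsurj]
    exact (h _ hpre).image_of_irreducible hf hsurj hirr

end NowhereDense

namespace MinimalPrimeSpace

theorem isOpen_D {R : Type*} [CommRing R] (a : R) : IsOpen (D a) :=
  (isTopologicalBasis_D R).isOpen ⟨a, rfl⟩

variable {X : Type*} [TopologicalSpace X] [CompactSpace X] [T2Space X]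

theorem exists_continuousMap_apply_eq_one_of_notMem {s : Set X} (hs : IsClosed s) {x : X}
    (hx : x ∉ s) : ∃ g : C(X, ℝ), g x = 1 ∧ ∀ y ∈ s, g y = 0 := by
  obtain ⟨g, hg0, hg1, -⟩ := exists_continuous_zero_one_of_isClosed hs isClosed_singleton
    (Set.disjoint_singleton_right.2 hx)
  exact ⟨g, hg1 rfl, fun y hy => hg0 hy⟩

theorem exists_forall_mem_apply_eq_zero (P : MinimalPrimeSpace C(X, ℝ)) :
    ∃ x : X, ∀ f ∈ P.1, f x = 0 := by
  obtain ⟨M, hM, hPM⟩ := Ideal.exists_le_maximal P.1 (Ideal.IsMinimalPrime.isPrime P.2).ne_top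
  -- By compactness, closed maximal ideals are exactly the ideals of functions vanishing at one
  -- point.
  have : IsClosed (M : Set C(X, ℝ)) := Ideal.IsMaximal.isClosed
  obtain ⟨x, rfl⟩ := (ContinuousMap.ideal_isMaximal_iff M).1 hM
  exact ⟨x, fun f hf => (ContinuousMap.mem_idealOfSet_compl_singleton x f).1 (hPM hf)⟩

/-- The point of `X` at which all members of a minimal prime ideal of `C(X, ℝ)` vanish. -/
noncomputable def point (P : MinimalPrimeSpace C(X, ℝ)) : X :=
  (exists_forall_mem_apply_eq_zero P).choose

theorem apply_point {P : MinimalPrimeSpace C(X, ℝ)} {f : C(X, ℝ)} (hf : f ∈ P.1) :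
    f (point P) = 0 :=
  (exists_forall_mem_apply_eq_zero P).choose_spec f hf

/-- Otherwise a Urysohn function `g` equal to 1 at `point P` and 0 on the support gives `f * g = 0`;
primality then puts `g` in `P`, although `g` does not vanish at `point P`. -/
theorem point_mem_tsupport {P : MinimalPrimeSpace C(X, ℝ)} {f : C(X, ℝ)} (hf : P ∈ D f) :
    point P ∈ tsupport f := by
  by_contra hP
  obtain ⟨g, hg1, hg0⟩ := exists_continuousMap_apply_eq_one_of_notMem (isClosed_tsupport f) hP
  have hfg : f * g ∈ P.1 := by
    convert P.1.zero_mem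
    ext y
    by_cases hy : f y = 0
    · simp [hy]
    · simp [hg0 y (subset_tsupport f hy)]
  rcases (Ideal.IsMinimalPrime.isPrime P.2).mem_or_mem hfg with h | h
  · exact hf h
  · exact one_ne_zero (hg1.symm.trans (apply_point h))

theorem continuous_point : Continuous (point : MinimalPrimeSpace C(X, ℝ) → X) := by
  refine continuous_def.2 fun U hU => isOpen_iff_mem_nhds.2 fun P hP => ?_
  obtain ⟨K, hK, hKclosed, hKU⟩ := exists_mem_nhds_isClosed_subset (hU.mem_nhds hP)
  obtain ⟨g, hg1, hg0⟩ := exists_continuousMap_apply_eq_one_of_notMem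
    isOpen_interior.isClosed_compl (not_not_intro (mem_interior_iff_mem_nhds.2 hK))
  -- `g` is supported in `K`, so `point` sends the neighbourhood `D g` of `P` into `tsupport g ⊆ K ⊆
  -- U`.
  refine Filter.mem_of_superset ((isOpen_D g).mem_nhds fun hg => ?_) fun Q hQ => hKU ?_
  · exact one_ne_zero (hg1.symm.trans (apply_point hg))
  · refine closure_minimal (fun y hy => ?_) hKclosed (point_mem_tsupport hQ)
    by_contra hyK
    exact hy (hg0 y fun hyi => hyK (interior_subset hyi))

/-- Makes `point` independent of choice: a bump function at `x` supported away from `point P` must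
lie in `P`. -/
theorem point_eq_of_forall_mem_apply_eq_zero {P : MinimalPrimeSpace C(X, ℝ)} {x : X}
    (h : ∀ f ∈ P.1, f x = 0) : point P = x := by
  by_contra hne
  obtain ⟨U, V, hU, hV, hPU, hxV, hUV⟩ := t2_separation hne
  obtain ⟨g, hg1, hg0⟩ := exists_continuousMap_apply_eq_one_of_notMem hV.isClosed_compl
    (not_not_intro hxV)
  refine one_ne_zero (hg1.symm.trans (h g ?_))
  by_contra hgP
  obtain ⟨y, hyU, hyg⟩ := mem_closure_iff.1 (point_mem_tsupport hgP) U hU hPU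
  exact hyg (hg0 y fun hyV => Set.disjoint_left.1 hUV hyU hyV)

theorem point_surjective : (point : MinimalPrimeSpace C(X, ℝ) → X).Surjective := by
  intro x
  have := (ContinuousMap.idealOf_compl_singleton_isMaximal (X := X) ℝ x).isPrime
  obtain ⟨P, hP, hPx⟩ := Ideal.exists_minimalPrimes_le
    (bot_le (a := ContinuousMap.idealOfSet ℝ ({x}ᶜ : Set X)))
  exact ⟨⟨P, hP⟩, point_eq_of_forall_mem_apply_eq_zero fun f hf =>
    (ContinuousMap.mem_idealOfSet_compl_singleton x f).1 (hPx hf)⟩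

theorem exists_isOpen_preimage_point_subset {V : Set (MinimalPrimeSpace C(X, ℝ))} (hV : IsOpen V)
    (hne : V.Nonempty) : ∃ U : Set X, IsOpen U ∧ U.Nonempty ∧ point ⁻¹' U ⊆ V := by
  obtain ⟨P, hP⟩ := hne
  obtain ⟨_, ⟨f, rfl⟩, hPf, hfV⟩ := (isTopologicalBasis_D C(X, ℝ)).exists_subset_of_mem_open hP hV
  -- If `f` is nonzero at `point Q`, then `f ∉ Q`, since members of `Q` vanish there.
  refine ⟨Function.support f, f.continuous.isOpen_support, ?_,
    fun Q hQ => hfV fun hfQ => hQ (apply_point hfQ)⟩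
  rw [Function.support_nonempty_iff]
  intro hf
  apply hPf
  convert P.1.zero_mem
  exact DFunLike.coe_injective hf

end MinimalPrimeSpace

theorem corollary3p11 (X : Type*) [TopologicalSpace X] [CompactSpace X] [T2Space X] :
    (∀ A : Set X, IsMeagre A → IsNowhereDense A) ↔
      (∀ B : Set (MinimalPrimeSpace C(X, ℝ)), IsMeagre B → IsNowhereDense B) :=
  forall_isMeagre_isNowhereDense_iff_of_irreducible MinimalPrimeSpace.continuous_point
    MinimalPrimeSpace.point_surjective
    fun _ => MinimalPrimeSpace.exists_isOpen_preimage_point_subset
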